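/- Let $n$ be an odd positive integer. For a profile $x=(x_1,\dots,x_n)\in(\mathbb{R}^2)^n$ of agents' locations and a point $y\in\mathbb{R}^2$ let $sc(y,x)=\sum_{i=1}^n\|y-x_i\|$, where $\|\cdot\|$ is the Euclidean norm. Let $c(x)$ be the coordinate-wise median of $x$, that is, the point whose first (second) coordinate is the median of the first (second) coordinates of $x_1,\dots,x_n$, and let $g(x)$ be the geometric median of $x$, a point of $\mathbb{R}^2$ that minimizes $y\mapsto sc(y,x)$. Let $$AR(x)=\frac{sc(c(x),x)}{sc(g(x),x)},$$ where the ratio is read as $1$ if $sc(g(x),x)=0$, i.e. if all agents are at the same point (then $c(x)=g(x)$). Then the worst-case approximation ratio of the coordinate-wise median mechanism is $$\sup_{x\in(\mathbb{R}^2)^n}AR(x)=\sqrt{2}\,\frac{\sqrt{n^2+1}}{n+1}.$$ Moreover, if $n=2m+1$ with $m\ge 1$, then the supremum is attained at the profile with $x_1=\dots=x_m=\left(\frac{m+1}{m},0\right)$, $x_{m+1}=\left(-\frac{m+1}{m},0\right)$ and $x_{m+2}=\dots=x_{2m+1}=(0,1)$. -/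

import Mathlib

/-- The plane `ℝ²` with the Euclidean norm. -/
abbrev Plane : Type := EuclideanSpace ℝ (Fin 2)

/-- The social cost `∑ᵢ ‖y - xᵢ‖` of the location `y` at the profile `x`. -/
noncomputable def socialCost {n : ℕ} (y : Plane) (x : Fin n → Plane) : ℝ :=
  ∑ i, ‖y - x i‖

/-- The median of an odd number of reals: the middle entry after sorting. -/
noncomputable def oddMedian {n : ℕ} (hn : Odd n) (a : Fin n → ℝ) : ℝ :=
  a (Tuple.sort a ⟨n / 2, Nat.div_lt_self hn.pos one_lt_two⟩)

/-- The coordinate-wise median mechanism. -/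
noncomputable def coordMedian {n : ℕ} (hn : Odd n) (x : Fin n → Plane) : Plane :=
  !₂[oddMedian hn (fun i => x i 0), oddMedian hn (fun i => x i 1)]

/-- `y` is a geometric median of `x`: it minimizes the social cost over the whole plane. -/
def IsGeometricMedian {n : ℕ} (y : Plane) (x : Fin n → Plane) : Prop :=
  ∀ z : Plane, socialCost y x ≤ socialCost z x

theorem exists_isGeometricMedian {n : ℕ} (hn : Odd n) (x : Fin n → Plane) :
    ∃ y : Plane, IsGeometricMedian y x := by
  have hc : Continuous (fun y : Plane => socialCost y x) := by
    unfold socialCost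
    fun_prop
  let i₀ : Fin n := ⟨0, hn.pos⟩
  have ht : Filter.Tendsto (fun y : Plane => socialCost y x)
      (Filter.cocompact Plane) Filter.atTop := by
    have h1 : Filter.Tendsto (fun y : Plane => ‖y‖ - ‖x i₀‖)
        (Filter.cocompact Plane) Filter.atTop := by
      simpa [sub_eq_add_neg] using
        Filter.tendsto_atTop_add_const_right _ (-‖x i₀‖) (tendsto_norm_cocompact_atTop (E := Plane))
    refine Filter.tendsto_atTop_mono (fun y => ?_) h1
    refine (norm_sub_norm_le y (x i₀)).trans ?_
    exact Finset.single_le_sum (f := fun i => ‖y - x i‖) (fun i _ => norm_nonneg _)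
      (Finset.mem_univ i₀)
  exact hc.exists_forall_le ht

/-- The geometric median mechanism. -/
noncomputable def geomMedian {n : ℕ} (hn : Odd n) (x : Fin n → Plane) : Plane :=
  Classical.choose (exists_isGeometricMedian hn x)

theorem geomMedian_spec {n : ℕ} (hn : Odd n) (x : Fin n → Plane) :
    IsGeometricMedian (geomMedian hn x) x :=
  Classical.choose_spec (exists_isGeometricMedian hn x)

open Classical in
/-- The approximation ratio `sc(c(x), x) / sc(g(x), x)` of the coordinate-wise median at the
profile `x`. If the optimal cost is `0`, then all agents are at the same point, the coordinate-wise
median is that point too, and the ratio `0 / 0` is read as `1`. -/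
noncomputable def approxRatio {n : ℕ} (hn : Odd n) (x : Fin n → Plane) : ℝ :=
  if socialCost (geomMedian hn x) x = 0 then 1
  else socialCost (coordMedian hn x) x / socialCost (geomMedian hn x) x

/-- The profile whose first `m` agents are at `(t, 0)`, whose next agent is at `(-t, 0)` and whose
remaining agents are at `(0, 1)`. -/
noncomputable def isoscelesProfile (n m : ℕ) (t : ℝ) : Fin n → Plane := fun i =>
  if (i : ℕ) < m then !₂[t, 0] else if (i : ℕ) = m then !₂[-t, 0] else !₂[0, 1]

/-! ### Medians of an odd number of reals -/

/-! Put the coordinate-wise median at the origin, let `g` be any competing point in the closed first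
quadrant (after reflections), and set `k = m / (m + 1)`. For each agent `p`, ‖p‖ is at most √(1 +
k²)‖g - p‖ plus a linear correction in `g`: each coordinate of `g` has weight `-k` if `p` is weakly
on the other side of the median there, and weight `1` otherwise (`norm_le_of_signs`). By the median
property, each coordinate's weights sum to at most m - (m + 1)k = 0 (`sum_ite_nonpos`), so summing
over agents removes the corrections and leaves the ratio bound √(1 + k²). In the isosceles profile
with `t = 1 / k`, comparison with (0, 1) makes every estimate tight. -/

theorem card_le_oddMedian {n m : ℕ} (hn : Odd n) (h : n = 2 * m + 1) (a : Fin n → ℝ) :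
    m + 1 ≤ (Finset.univ.filter fun i => a i ≤ oddMedian hn a).card := by
  have hc : (Finset.Iic (⟨n / 2, Nat.div_lt_self hn.pos one_lt_two⟩ : Fin n)).card = m + 1 := by
    rw [Fin.card_Iic]; simp only; omega
  rw [← hc, ← Finset.card_map (Tuple.sort a).toEmbedding]
  refine Finset.card_le_card fun i hi => ?_
  obtain ⟨j, hj, rfl⟩ := Finset.mem_map.1 hi
  exact Finset.mem_filter.2 ⟨Finset.mem_univ _, Tuple.monotone_sort a (Finset.mem_Iic.1 hj)⟩

theorem card_oddMedian_le {n m : ℕ} (hn : Odd n) (h : n = 2 * m + 1) (a : Fin n → ℝ) :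
    m + 1 ≤ (Finset.univ.filter fun i => oddMedian hn a ≤ a i).card := by
  have hc : (Finset.Ici (⟨n / 2, Nat.div_lt_self hn.pos one_lt_two⟩ : Fin n)).card = m + 1 := by
    rw [Fin.card_Ici]; simp only; omega
  rw [← hc, ← Finset.card_map (Tuple.sort a).toEmbedding]
  refine Finset.card_le_card fun i hi => ?_
  obtain ⟨j, hj, rfl⟩ := Finset.mem_map.1 hi
  exact Finset.mem_filter.2 ⟨Finset.mem_univ _, Tuple.monotone_sort a (Finset.mem_Ici.1 hj)⟩

theorem le_of_card_le_of_card_ge {n m : ℕ} (h : n = 2 * m + 1) (a : Fin n → ℝ) {u v : ℝ}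
    (hu : m + 1 ≤ (Finset.univ.filter fun i => a i ≤ u).card)
    (hv : m + 1 ≤ (Finset.univ.filter fun i => v ≤ a i).card) : v ≤ u := by
  by_contra! huv
  have hd : Disjoint (Finset.univ.filter fun i => a i ≤ u)
      (Finset.univ.filter fun i => v ≤ a i) := by
    rw [Finset.disjoint_filter]
    intro i _ h1 h2
    linarith
  have := Finset.card_le_univ (Finset.disjUnion _ _ hd)
  rw [Finset.card_disjUnion, Fintype.card_fin] at this
  omega

theorem oddMedian_eq {n m : ℕ} (hn : Odd n) (h : n = 2 * m + 1) (a : Fin n → ℝ) {v : ℝ}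
    (hle : m + 1 ≤ (Finset.univ.filter fun i => a i ≤ v).card)
    (hge : m + 1 ≤ (Finset.univ.filter fun i => v ≤ a i).card) : oddMedian hn a = v :=
  le_antisymm (le_of_card_le_of_card_ge h a hle (card_oddMedian_le hn h a))
    (le_of_card_le_of_card_ge h a (card_le_oddMedian hn h a) hge)

/-! ### The pointwise inequality -/

theorem Plane.norm_eq_sqrt (p : Plane) : ‖p‖ = √(p 0 ^ 2 + p 1 ^ 2) := by
  simp [EuclideanSpace.norm_eq, Fin.sum_univ_two]

/-- Cauchy–Schwarz against the vector (k, 1). -/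
theorem Plane.mul_abs_add_abs_le (k : ℝ) (p : Plane) :
    k * |p 0| + |p 1| ≤ √(1 + k ^ 2) * ‖p‖ := by
  rw [Plane.norm_eq_sqrt, ← Real.sqrt_mul (by positivity)]
  apply Real.le_sqrt_of_sq_le
  rw [← sq_abs (p 0), ← sq_abs (p 1)]
  nlinarith [sq_nonneg (|p 0| - k * |p 1|)]

theorem Plane.abs_add_mul_abs_le (k : ℝ) (p : Plane) :
    |p 0| + k * |p 1| ≤ √(1 + k ^ 2) * ‖p‖ := by
  rw [Plane.norm_eq_sqrt, ← Real.sqrt_mul (by positivity)]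
  apply Real.le_sqrt_of_sq_le
  rw [← sq_abs (p 0), ← sq_abs (p 1)]
  nlinarith [sq_nonneg (k * |p 0| - |p 1|)]

/-- Moving `p` towards `g` does not decrease `‖p‖ - r * ‖g - p‖` when `1 ≤ r`. -/
theorem norm_le_of_norm_lineMap_le {E : Type*} [NormedAddCommGroup E] [NormedSpace ℝ E]
    {p g : E} {s r d : ℝ} (hs : 0 ≤ s) (hs' : s ≤ 1) (hr : 1 ≤ r)
    (h : ‖p + s • (g - p)‖ ≤ r * ‖g - (p + s • (g - p))‖ + d) : ‖p‖ ≤ r * ‖g - p‖ + d := by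
  have h1 : g - (p + s • (g - p)) = (1 - s) • (g - p) := by module
  have h2 : ‖p‖ ≤ ‖p + s • (g - p)‖ + s * ‖g - p‖ := by
    calc ‖p‖ = ‖(p + s • (g - p)) - s • (g - p)‖ := by congr 1; module
      _ ≤ _ := norm_sub_le _ _
      _ = _ := by rw [norm_smul, Real.norm_of_nonneg hs]
  rw [h1, norm_smul, Real.norm_of_nonneg (sub_nonneg.2 hs')] at h
  nlinarith [mul_nonneg (sub_nonneg.2 hr) (mul_nonneg hs (norm_nonneg (g - p)))]

/-- A segment from `x ≤ 0` to `a ≥ 0` passes through `0`. -/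
theorem exists_add_mul_sub_eq_zero {x a : ℝ} (hx : x ≤ 0) (ha : 0 ≤ a) :
    ∃ s, 0 ≤ s ∧ s ≤ 1 ∧ x + s * (a - x) = 0 := by
  rcases hx.eq_or_lt with rfl | hx
  · exact ⟨0, le_rfl, zero_le_one, by simp⟩
  · have : 0 < a - x := by linarith
    refine ⟨-x / (a - x), div_nonneg (by linarith) this.le, ?_, ?_⟩
    · rw [div_le_one this]; linarith
    · field_simp; ring

section Pointwise

variable {k : ℝ} {p g : Plane}

theorem one_le_sqrt_one_add_sq (k : ℝ) : 1 ≤ √(1 + k ^ 2) :=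
  Real.one_le_sqrt.2 (by nlinarith [sq_nonneg k])

/-- Slide `p` towards `g` until it meets the second axis. There the norm is |q 1| ≤ g 1 + |g 1 - q
1|, and Cauchy–Schwarz absorbs |g 1 - q 1| + k * g 0. -/
theorem norm_le_of_fst_nonpos (hp : p 0 ≤ 0) (ha : 0 ≤ g 0) (hb : 0 ≤ g 1) :
    ‖p‖ ≤ √(1 + k ^ 2) * ‖g - p‖ + (-k * g 0 + g 1) := by
  obtain ⟨s, hs, hs', h0⟩ := exists_add_mul_sub_eq_zero hp ha
  refine norm_le_of_norm_lineMap_le hs hs' (one_le_sqrt_one_add_sq k) ?_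
  generalize hq : p + s • (g - p) = q
  have hq0 : q 0 = 0 := by simpa [← hq] using h0
  have h1 := Plane.mul_abs_add_abs_le k (g - q)
  rw [Plane.norm_eq_sqrt q, hq0]
  simp only [PiLp.sub_apply, hq0, sub_zero, abs_of_nonneg ha] at h1
  rw [zero_pow two_ne_zero, zero_add, Real.sqrt_sq_eq_abs]
  have := abs_sub_abs_le_abs_sub (q 1) (g 1)
  rw [abs_sub_comm, abs_of_nonneg hb] at this
  linarith

theorem norm_le_of_snd_nonpos (hp : p 1 ≤ 0) (ha : 0 ≤ g 0) (hb : 0 ≤ g 1) :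
    ‖p‖ ≤ √(1 + k ^ 2) * ‖g - p‖ + (g 0 + -k * g 1) := by
  obtain ⟨s, hs, hs', h0⟩ := exists_add_mul_sub_eq_zero hp hb
  refine norm_le_of_norm_lineMap_le hs hs' (one_le_sqrt_one_add_sq k) ?_
  generalize hq : p + s • (g - p) = q
  have hq1 : q 1 = 0 := by simpa [← hq] using h0
  have h1 := Plane.abs_add_mul_abs_le k (g - q)
  rw [Plane.norm_eq_sqrt q, hq1]
  simp only [PiLp.sub_apply, hq1, sub_zero, abs_of_nonneg hb] at h1
  rw [zero_pow two_ne_zero, add_zero, Real.sqrt_sq_eq_abs]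
  have := abs_sub_abs_le_abs_sub (q 0) (g 0)
  rw [abs_sub_comm, abs_of_nonneg ha] at this
  linarith

theorem norm_le_of_nonpos (hk : k ≤ 1) (hp0 : p 0 ≤ 0) (hp1 : p 1 ≤ 0)
    (ha : 0 ≤ g 0) (hb : 0 ≤ g 1) :
    ‖p‖ ≤ √(1 + k ^ 2) * ‖g - p‖ + (-k * g 0 + -k * g 1) := by
  obtain ⟨s, hs, hs', h0⟩ := exists_add_mul_sub_eq_zero hp0 ha
  obtain ⟨t, ht, ht', h1⟩ := exists_add_mul_sub_eq_zero hp1 hb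
  -- Stop at whichever axis is met first, so that the other coordinate is still nonpositive.
  -- Cauchy–Schwarz then gives one weight `-k` and one weight `-1`, and `k ≤ 1` weakens the latter.
  rcases le_total s t with hst | hst
  · refine norm_le_of_norm_lineMap_le hs hs' (one_le_sqrt_one_add_sq k) ?_
    generalize hq : p + s • (g - p) = q
    have hq0 : q 0 = 0 := by simpa [← hq] using h0
    have hq1 : q 1 ≤ 0 := by
      have : q 1 = p 1 + s * (g 1 - p 1) := by simp [← hq]
      nlinarith
    have h1 := Plane.mul_abs_add_abs_le k (g - q)
    rw [Plane.norm_eq_sqrt q, hq0]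
    simp only [PiLp.sub_apply, hq0, sub_zero, abs_of_nonneg ha] at h1
    rw [zero_pow two_ne_zero, zero_add, Real.sqrt_sq_eq_abs, abs_of_nonpos hq1]
    rw [abs_of_nonneg (by linarith : 0 ≤ g 1 - q 1)] at h1
    nlinarith
  · refine norm_le_of_norm_lineMap_le ht ht' (one_le_sqrt_one_add_sq k) ?_
    generalize hq : p + t • (g - p) = q
    have hq1 : q 1 = 0 := by simpa [← hq] using h1
    have hq0 : q 0 ≤ 0 := by
      have : q 0 = p 0 + t * (g 0 - p 0) := by simp [← hq]
      nlinarith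
    have h1 := Plane.abs_add_mul_abs_le k (g - q)
    rw [Plane.norm_eq_sqrt q, hq1]
    simp only [PiLp.sub_apply, hq1, sub_zero, abs_of_nonneg hb] at h1
    rw [zero_pow two_ne_zero, add_zero, Real.sqrt_sq_eq_abs, abs_of_nonpos hq0]
    rw [abs_of_nonneg (by linarith : 0 ≤ g 0 - q 0)] at h1
    nlinarith

theorem norm_le_add_add (ha : 0 ≤ g 0) (hb : 0 ≤ g 1) :
    ‖p‖ ≤ √(1 + k ^ 2) * ‖g - p‖ + (g 0 + g 1) := by
  have h1 : ‖p‖ ≤ ‖g‖ + ‖g - p‖ := by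
    simpa using norm_sub_le g (g - p)
  have h2 : ‖g‖ ≤ g 0 + g 1 := by
    rw [Plane.norm_eq_sqrt]
    exact Real.sqrt_le_iff.2 ⟨by positivity, by nlinarith [mul_nonneg ha hb]⟩
  nlinarith [one_le_sqrt_one_add_sq k, norm_nonneg (g - p)]

/-- Ties with the median receive the favourable weight `-k`, matching the weak inequalities in the
median counts. -/
theorem norm_le_of_nonneg (hk : k ≤ 1) (ha : 0 ≤ g 0) (hb : 0 ≤ g 1) :
    ‖p‖ ≤ √(1 + k ^ 2) * ‖g - p‖ +
      ((if p 0 ≤ 0 then -k else 1) * g 0 + (if p 1 ≤ 0 then -k else 1) * g 1) := by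
  split_ifs with h0 h1 h1
  · exact norm_le_of_nonpos hk h0 h1 ha hb
  · simpa using norm_le_of_fst_nonpos h0 ha hb
  · simpa using norm_le_of_snd_nonpos h1 ha hb
  · simpa using norm_le_add_add ha hb

theorem norm_le_of_signs (hk : k ≤ 1) {σ τ : ℝ} (hσ : σ ^ 2 = 1) (hτ : τ ^ 2 = 1)
    (ha : 0 ≤ σ * g 0) (hb : 0 ≤ τ * g 1) :
    ‖p‖ ≤ √(1 + k ^ 2) * ‖g - p‖ +
      ((if σ * p 0 ≤ 0 then -k else 1) * (σ * g 0) +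
        (if τ * p 1 ≤ 0 then -k else 1) * (τ * g 1)) := by
  -- Reflections in the axes are isometries, which reduces to the first quadrant.
  have hnorm : ∀ q : Plane, ‖(!₂[σ * q 0, τ * q 1] : Plane)‖ = ‖q‖ := fun q => by
    simp [Plane.norm_eq_sqrt, mul_pow, hσ, hτ]
  have hsub : (!₂[σ * g 0, τ * g 1] - !₂[σ * p 0, τ * p 1] : Plane) =
      !₂[σ * (g - p) 0, τ * (g - p) 1] := by
    ext j
    fin_cases j <;> simp [mul_sub]
  have h := norm_le_of_nonneg (p := !₂[σ * p 0, τ * p 1]) (g := !₂[σ * g 0, τ * g 1]) hk ha hb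
  rw [hsub, hnorm, hnorm] at h
  exact h

end Pointwise

/-! ### The upper bound -/

theorem exists_sign_mul_nonneg (a : ℝ) : ∃ σ : ℝ, (σ = 1 ∨ σ = -1) ∧ 0 ≤ σ * a := by
  rcases le_total 0 a with h | h
  · exact ⟨1, .inl rfl, by simpa⟩
  · exact ⟨-1, .inr rfl, by simpa⟩

/-- At least half of the reals `a i` lie on each side of their median. -/
theorem card_sign_mul_sub_oddMedian {n m : ℕ} (hn : Odd n) (h : n = 2 * m + 1) (a : Fin n → ℝ)
    {σ : ℝ} (hσ : σ = 1 ∨ σ = -1) :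
    m + 1 ≤ (Finset.univ.filter fun i => σ * (a i - oddMedian hn a) ≤ 0).card := by
  rcases hσ with rfl | rfl
  · simpa using card_le_oddMedian hn h a
  · simpa using card_oddMedian_le hn h a

theorem sum_ite_nonpos {n m : ℕ} (h : n = 2 * m + 1) (P : Fin n → Prop) [DecidablePred P]
    (hP : m + 1 ≤ (Finset.univ.filter P).card) :
    ∑ i, (if P i then -((m : ℝ) / (m + 1)) else 1) ≤ 0 := by
  have hc := Finset.card_filter_add_card_filter_not (s := (Finset.univ : Finset (Fin n))) P
  rw [Finset.card_univ, Fintype.card_fin] at hc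
  rw [Finset.sum_ite, Finset.sum_const, Finset.sum_const]
  simp only [nsmul_eq_mul, mul_one]
  have h1 : ((Finset.univ.filter fun i => ¬ P i).card : ℝ) ≤ m := by
    exact_mod_cast (by omega)
  have h2 : ((m : ℝ) + 1) ≤ (Finset.univ.filter P).card := by exact_mod_cast hP
  have h3 : ((m : ℝ) + 1) * (m / (m + 1)) = m := by field_simp
  have h4 : (0 : ℝ) ≤ m / (m + 1) := by positivity
  nlinarith

theorem socialCost_coordMedian_le {n m : ℕ} (hn : Odd n) (h : n = 2 * m + 1)
    (x : Fin n → Plane) (y : Plane) :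
    socialCost (coordMedian hn x) x ≤ √(1 + ((m : ℝ) / (m + 1)) ^ 2) * socialCost y x := by
  have hk : (m : ℝ) / (m + 1) ≤ 1 := (div_le_one (by positivity)).2 (by linarith)
  set c := coordMedian hn x with hc
  obtain ⟨σ, hσ, ha⟩ := exists_sign_mul_nonneg ((y - c) 0)
  obtain ⟨τ, hτ, hb⟩ := exists_sign_mul_nonneg ((y - c) 1)
  have hp : ∀ i, ‖c - x i‖ ≤ √(1 + ((m : ℝ) / (m + 1)) ^ 2) * ‖y - x i‖ +
      ((if σ * (x i - c) 0 ≤ 0 then -((m : ℝ) / (m + 1)) else 1) * (σ * (y - c) 0) +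
        (if τ * (x i - c) 1 ≤ 0 then -((m : ℝ) / (m + 1)) else 1) * (τ * (y - c) 1)) := by
    intro i
    have := norm_le_of_signs (p := x i - c) hk (by rcases hσ with rfl | rfl <;> norm_num)
      (by rcases hτ with rfl | rfl <;> norm_num) ha hb
    rwa [sub_sub_sub_cancel_right, norm_sub_rev (x i) c] at this
  have h0 := sum_ite_nonpos h (fun i => σ * (x i - c) 0 ≤ 0)
    (by simpa [hc, coordMedian] using card_sign_mul_sub_oddMedian hn h (fun i => x i 0) hσ)
  have h1 := sum_ite_nonpos h (fun i => τ * (x i - c) 1 ≤ 0)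
    (by simpa [hc, coordMedian] using card_sign_mul_sub_oddMedian hn h (fun i => x i 1) hτ)
  have hs := Finset.sum_le_sum fun i (_ : i ∈ Finset.univ) => hp i
  rw [Finset.sum_add_distrib, Finset.sum_add_distrib, ← Finset.mul_sum, ← Finset.sum_mul,
    ← Finset.sum_mul] at hs
  unfold socialCost
  linarith [mul_nonpos_of_nonpos_of_nonneg h0 ha, mul_nonpos_of_nonpos_of_nonneg h1 hb]

theorem socialCost_nonneg {n : ℕ} (y : Plane) (x : Fin n → Plane) : 0 ≤ socialCost y x :=
  Finset.sum_nonneg fun _ _ => norm_nonneg _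

theorem approxRatio_le {n m : ℕ} (hn : Odd n) (h : n = 2 * m + 1) (x : Fin n → Plane) :
    approxRatio hn x ≤ √(1 + ((m : ℝ) / (m + 1)) ^ 2) := by
  unfold approxRatio
  split_ifs with h0
  · exact one_le_sqrt_one_add_sq _
  · exact (div_le_iff₀ ((socialCost_nonneg _ _).lt_of_ne' h0)).2
      (socialCost_coordMedian_le hn h x _)

/-! ### The extremal profile -/

theorem coordMedian_isoscelesProfile {n m : ℕ} (hn : Odd n) (h : n = 2 * m + 1) (hm : 1 ≤ m)
    {t : ℝ} (ht : 0 ≤ t) : coordMedian hn (isoscelesProfile n m t) = 0 := by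
  subst h
  have e0 : oddMedian hn (fun i => isoscelesProfile (2 * m + 1) m t i 0) = 0 := by
    refine oddMedian_eq hn rfl _ ?_ ?_
    · have : (Finset.Ici (⟨m, by omega⟩ : Fin (2 * m + 1))).card = m + 1 := by
        rw [Fin.card_Ici]; simp only; omega
      rw [← this]
      refine Finset.card_le_card fun i hi => ?_
      have hi : m ≤ (i : ℕ) := Fin.le_def.1 (Finset.mem_Ici.1 hi)
      refine Finset.mem_filter.2 ⟨Finset.mem_univ _, ?_⟩
      simp only [isoscelesProfile]
      rw [if_neg (by omega)]
      split_ifs <;> simp [ht]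
    · have : (Finset.univ.erase (⟨m, by omega⟩ : Fin (2 * m + 1))).card = 2 * m := by
        rw [Finset.card_erase_of_mem (Finset.mem_univ _)]; simp
      -- Only agent `m` has a negative first coordinate; `1 ≤ m` is needed for the other 2m to
      -- suffice.
      refine le_trans (by omega : m + 1 ≤ 2 * m) (this.symm.le.trans ?_)
      refine Finset.card_le_card fun i hi => ?_
      have hi : (i : ℕ) ≠ m := fun e => (Finset.mem_erase.1 hi).1 (Fin.ext e)
      refine Finset.mem_filter.2 ⟨Finset.mem_univ _, ?_⟩
      simp only [isoscelesProfile]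
      rw [if_neg hi]
      split_ifs <;> simp [ht]
  have e1 : oddMedian hn (fun i => isoscelesProfile (2 * m + 1) m t i 1) = 0 := by
    refine oddMedian_eq hn rfl _ ?_ ?_
    · have : (Finset.Iic (⟨m, by omega⟩ : Fin (2 * m + 1))).card = m + 1 := by
        rw [Fin.card_Iic]
      rw [← this]
      refine Finset.card_le_card fun i hi => ?_
      have hi : (i : ℕ) ≤ m := Fin.le_def.1 (Finset.mem_Iic.1 hi)
      refine Finset.mem_filter.2 ⟨Finset.mem_univ _, ?_⟩
      simp only [isoscelesProfile]
      split_ifs <;> first | omega | simp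
    · rw [Finset.filter_true_of_mem]
      · simp; omega
      · intro i _
        simp only [isoscelesProfile]
        split_ifs <;> simp
  ext j
  fin_cases j
  · simpa [coordMedian] using e0
  · simpa [coordMedian] using e1

theorem socialCost_isoscelesProfile (m : ℕ) (t : ℝ) (y : Plane) :
    socialCost y (isoscelesProfile (2 * m + 1) m t) =
      m * ‖y - !₂[t, 0]‖ + ‖y - !₂[-t, 0]‖ + m * ‖y - !₂[0, 1]‖ := by
  unfold socialCost isoscelesProfile
  rw [Fin.sum_univ_eq_sum_range (fun i => ‖y - (if i < m then !₂[t, 0] else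
    if i = m then !₂[-t, 0] else !₂[0, 1] : Plane)‖) (2 * m + 1),
    show 2 * m + 1 = (m + 1) + m by ring, Finset.sum_range_add, Finset.sum_range_succ]
  rw [Finset.sum_congr rfl (g := fun _ => ‖y - !₂[t, 0]‖)
    fun i hi => by rw [if_pos (Finset.mem_range.1 hi)]]
  have hlast : ∀ i ∈ Finset.range m, ‖y - (if m + 1 + i < m then !₂[t, 0] else
      if m + 1 + i = m then !₂[-t, 0] else !₂[0, 1] : Plane)‖ = ‖y - !₂[0, 1]‖ := fun i _ => by
    rw [if_neg (by omega), if_neg (by omega)]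
  rw [Finset.sum_congr rfl hlast]
  simp

theorem approxRatio_isoscelesProfile {n m : ℕ} (hn : Odd n) (h : n = 2 * m + 1) (hm : 1 ≤ m) :
    approxRatio hn (isoscelesProfile n m (((m : ℝ) + 1) / m)) =
      √(1 + ((m : ℝ) / (m + 1)) ^ 2) := by
  refine le_antisymm (approxRatio_le hn h _) ?_
  have hm0 : (0 : ℝ) < m := by exact_mod_cast hm
  set k : ℝ := (m : ℝ) / (m + 1) with hk
  set t : ℝ := ((m : ℝ) + 1) / m with ht
  have htk : t * k = 1 := by rw [ht, hk]; field_simp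
  have ht0 : 0 < t := by positivity
  have hmk : ((m : ℝ) + 1) * k = m := by rw [hk]; field_simp
  set x := isoscelesProfile n m t with hx
  have hc : socialCost (coordMedian hn x) x = ((m : ℝ) + 1) * t + m := by
    rw [hx, coordMedian_isoscelesProfile hn h hm ht0.le]
    subst h
    rw [socialCost_isoscelesProfile]
    simp [Plane.norm_eq_sqrt, Real.sqrt_sq ht0.le]
    ring
  have hy : socialCost !₂[0, 1] x = ((m : ℝ) + 1) * √(1 + t ^ 2) := by
    rw [hx]
    subst h
    rw [socialCost_isoscelesProfile]
    simp [Plane.norm_eq_sqrt]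
    ring_nf
  -- The geometric median need not be computed: an upper bound on the optimal cost already bounds
  -- the ratio from below.
  have hle : socialCost (geomMedian hn x) x ≤ ((m : ℝ) + 1) * √(1 + t ^ 2) :=
    hy ▸ geomMedian_spec hn x _
  have hub := socialCost_coordMedian_le hn h x (geomMedian hn x)
  -- By the upper bound, zero optimal cost would force `coordMedian` to cost zero too.
  have hpos : 0 < socialCost (geomMedian hn x) x := by
    refine (socialCost_nonneg _ _).lt_of_ne' fun h0 => ?_
    rw [h0, mul_zero, hc] at hub
    nlinarith
  rw [approxRatio, if_neg hpos.ne', le_div_iff₀ hpos, hc]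
  have hsq : √(1 + t ^ 2) = t * √(1 + k ^ 2) := by
    rw [← Real.sqrt_sq ht0.le, ← Real.sqrt_mul (sq_nonneg t), Real.sqrt_sq ht0.le]
    congr 1
    linear_combination (-t * k - 1) * htk
  calc √(1 + k ^ 2) * socialCost (geomMedian hn x) x
      ≤ √(1 + k ^ 2) * (((m : ℝ) + 1) * √(1 + t ^ 2)) := by gcongr
    _ = ((m : ℝ) + 1) * t * (√(1 + k ^ 2) * √(1 + k ^ 2)) := by rw [hsq]; ring
    _ = ((m : ℝ) + 1) * t * (1 + k ^ 2) := by rw [Real.mul_self_sqrt (by positivity)]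
    _ = ((m : ℝ) + 1) * t + m := by linear_combination (((m : ℝ) + 1) * k) * htk + hmk

theorem sqrt_two_mul_sqrt_div {n m : ℕ} (h : n = 2 * m + 1) :
    √2 * (√((n : ℝ) ^ 2 + 1) / ((n : ℝ) + 1)) = √(1 + ((m : ℝ) / (m + 1)) ^ 2) := by
  have hn0 : (0 : ℝ) ≤ (n : ℝ) + 1 := by positivity
  rw [← mul_div_assoc, ← Real.sqrt_mul zero_le_two, ← Real.sqrt_sq hn0,
    ← Real.sqrt_div (by positivity)]
  subst h
  congr 1
  push_cast
  field_simp
  ring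

theorem exists_approxRatio_eq {n m : ℕ} (hn : Odd n) (h : n = 2 * m + 1) :
    ∃ x, approxRatio hn x = √(1 + ((m : ℝ) / (m + 1)) ^ 2) := by
  rcases Nat.eq_zero_or_pos m with rfl | hm
  -- With a single agent the bound is 1, attained through the 0 / 0 convention.
  · refine ⟨fun _ => 0, ?_⟩
    have h0 : socialCost (geomMedian hn fun _ => 0) (fun _ => 0) = 0 :=
      le_antisymm (by simpa [socialCost] using geomMedian_spec hn (fun _ => 0) 0)
        (socialCost_nonneg _ _)
    simp [approxRatio, h0]
  · exact ⟨_, approxRatio_isoscelesProfile hn h hm⟩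

theorem mainTheorem1 (n : ℕ) (hn : Odd n) :
    IsLUB (Set.range (fun x : Fin n → Plane => approxRatio hn x))
      (√2 * (√((n : ℝ) ^ 2 + 1) / ((n : ℝ) + 1))) ∧
    ∀ m : ℕ, 1 ≤ m → n = 2 * m + 1 →
      approxRatio hn (isoscelesProfile n m (((m : ℝ) + 1) / (m : ℝ))) =
        √2 * (√((n : ℝ) ^ 2 + 1) / ((n : ℝ) + 1)) := by
  constructor
  · obtain ⟨m, h⟩ := id hn
    rw [sqrt_two_mul_sqrt_div h]
    refine IsGreatest.isLUB ⟨exists_approxRatio_eq hn h, ?_⟩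
    rintro _ ⟨x, rfl⟩
    exact approxRatio_le hn h x
  · intro m hm h
    rw [sqrt_two_mul_sqrt_div h]
    exact approxRatio_isoscelesProfile hn h hm
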